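/- Let $G$ be a finite group of order $n$ and let $f : G \to \mathbb{Q}$ be a class function (that is, $f(ghg^{-1}) = f(h)$ for all $g, h \in G$) satisfying $f(g) = f(g^{-1})$ for all $g \in G$. Let $\Gamma_f = \operatorname{Cay}(G,f)$ be the Cayley colour graph: the undirected graph (loops allowed) with vertex set $G$ in which $\{g,h\}$ is an edge of colour $f(gh^{-1})$ whenever $f(gh^{-1}) \neq 0$. Its adjacency matrix is $A(\Gamma_f) = [f(gh^{-1})]_{g,h \in G}$, and its eigenvalues are the complex zeros of the characteristic polynomial of $A(\Gamma_f)$. Call $\Gamma_f$ rational (respectively integral) if all its eigenvalues are rational numbers (respectively integers). For $h \in (\mathbb{Z}/n\mathbb{Z})^{*}$ let $f^h : G \to \mathbb{Q}$ be the function $f^h(g) = f(g^h)$, which is well defined since $g^n = 1$. Then: (1) $\Gamma_f$ is rational if and only if $f^h = f$ for all $h \in (\mathbb{Z}/n\mathbb{Z})^{*}$. (2) If moreover $f(G) \subseteq \mathbb{Z}$, then $\Gamma_f$ is integral if and only if $f^h = f$ for all $h \in (\mathbb{Z}/n\mathbb{Z})^{*}$. -/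

import Mathlib

/-- An undirected graph (loops allowed) on the vertex set `V` whose edges carry nonzero rational
colours: `colour u v = 0` means that `u` and `v` are not joined by an edge. -/
structure ColourGraph (V : Type*) where
  colour : V → V → ℚ
  symm : ∀ u v, colour u v = colour v u

namespace ColourGraph

/-- The edges are the unordered pairs of vertices with nonzero colour. -/
def edgeSet {V : Type*} (Γ : ColourGraph V) : Set (Sym2 V) :=
  {e | ∃ u v, e = s(u, v) ∧ Γ.colour u v ≠ 0}

/-- The adjacency matrix: its `(u, v)`-entry is the colour of `{u, v}`, and `0` for a non-edge. -/
def adjMatrix {V : Type*} (Γ : ColourGraph V) : Matrix V V ℚ :=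
  Matrix.of Γ.colour

/-- The adjacency polynomial. -/
noncomputable def adjPolynomial {V : Type*} [Fintype V] [DecidableEq V] (Γ : ColourGraph V) :
    Polynomial ℚ :=
  Γ.adjMatrix.charpoly

/-- The spectrum: the multiset of complex zeros of the adjacency polynomial, that is, of the
eigenvalues of the adjacency matrix. -/
noncomputable def spectrum {V : Type*} [Fintype V] [DecidableEq V] (Γ : ColourGraph V) :
    Multiset ℂ :=
  Γ.adjPolynomial.aroots ℂ

/-- All eigenvalues are rational numbers. -/
def IsRational {V : Type*} [Fintype V] [DecidableEq V] (Γ : ColourGraph V) : Prop :=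
  ∀ μ ∈ Γ.spectrum, ∃ q : ℚ, μ = (q : ℂ)

/-- All eigenvalues are integers. -/
def IsIntegral {V : Type*} [Fintype V] [DecidableEq V] (Γ : ColourGraph V) : Prop :=
  ∀ μ ∈ Γ.spectrum, ∃ z : ℤ, μ = (z : ℂ)

end ColourGraph

/-- The Cayley colour graph `Γ_f = Cay(G, f)`: the vertices are the elements of `G`, and
`{g, h}` is an edge of colour `f (g * h⁻¹)` whenever that value is nonzero. -/
def cayleyColourGraph {G : Type*} [Group G] (f : G → ℚ) (hf : ∀ g, f g = f g⁻¹) :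
    ColourGraph G where
  colour g h := f (g * h⁻¹)
  symm g h := by rw [hf (g * h⁻¹), mul_inv_rev, inv_inv]

/-- `f` is constant on conjugacy classes. -/
def IsClassFunction {G α : Type*} [Group G] (f : G → α) : Prop :=
  ∀ g h : G, f (g * h * g⁻¹) = f h

/-- The function `f^k : g ↦ f (g ^ k)`, for an integer `k`. -/
def powFun {G α : Type*} [Group G] (f : G → α) (k : ℤ) : G → α :=
  fun g => f (g ^ k)

/-- The function `f^h` for a unit `h` of `ℤ/n`, where `n` is the order of `G`: it is `f^k` for the
representative `0 ≤ k < n` of `h`. By `unitPowFun_eq`, any other representative gives the same. -/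
def unitPowFun {G α : Type*} [Group G] [Fintype G] (f : G → α)
    (h : (ZMod (Fintype.card G))ˣ) : G → α :=
  powFun f ((h : ZMod (Fintype.card G)).val : ℤ)

theorem unitPowFun_eq {G α : Type*} [Group G] [Fintype G] (f : G → α)
    (h : (ZMod (Fintype.card G))ˣ) (k : ℤ) (hk : (k : ZMod (Fintype.card G)) = h) :
    unitPowFun f h = powFun f k := by
  funext g
  have h1 : (((h : ZMod (Fintype.card G)).val : ℤ) : ZMod (Fintype.card G)) = (k : ℤ) := by
    rw [hk]; simp
  have h2 := (ZMod.intCast_eq_intCast_iff _ _ _).1 h1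
  have h3 : (orderOf g : ℤ) ∣ (Fintype.card G : ℤ) := Int.natCast_dvd_natCast.2 orderOf_dvd_card
  unfold unitPowFun powFun
  rw [zpow_eq_zpow_iff_modEq.2 (h2.of_dvd h3)]

/-! Write `A` as the sum of `μ • E_μ` over its eigenvalues, with `E_μ` the spectral projections;
this is possible since `A` is rational and symmetric. Right translations `R_v` commute with `A`, and
`tr (A * R_v) = n * f v`. Each `tr (E_μ * R_v)` is a sum of `n`-th roots of unity, so a Galois
automorphism `σ` with `σ ζ = ζ ^ k` sends it to `tr (E_μ * R_(v^k))`
(`map_trace_mul_eq_trace_mul_pow`). Hence `n * f v = ∑ σ μ * tr (E_μ * R_(v^k))`, while `n * f (v ^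
k) = ∑ μ * tr (E_μ * R_(v^k))`.

Rational eigenvalues make the two sums equal. Conversely, if `f (v ^ k) = f v`, then `∑ (σ μ - μ) •
E_μ` is trace-orthogonal to every `R_w`, hence to every `E_μ` (`trace_mul_aeval_eq_zero`); as `tr
E_μ ≠ 0`, `σ` fixes `μ`. -/

open Polynomial

/-! ### Spectral projections as Lagrange polynomials in a matrix. -/

section SpectralProjections

variable {K : Type*} [Field K] {m : Type*} [Fintype m] [DecidableEq m]

theorem eval_eq_zero_of_isRoot_charpoly {M : Matrix m m K} {μ : K} (hμ : M.charpoly.IsRoot μ)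
    {p : K[X]} (hp : aeval M p = 0) : p.eval μ = 0 := by
  have hspec := Matrix.mem_spectrum_iff_isRoot_charpoly.2 hμ
  have h := spectrum.subset_polynomial_aeval M p ⟨μ, hspec, rfl⟩
  have hne : Nontrivial (Matrix m m K) := by
    by_contra hcon
    rw [not_nontrivial_iff_subsingleton] at hcon
    exact hspec (isUnit_of_subsingleton _)
  rw [hp, spectrum.zero_eq, Set.mem_singleton_iff] at h
  exact h

theorem aeval_eq_zero_of_eval_eq_zero {s : Finset K} {M : Matrix m m K}
    (hM : aeval M (Lagrange.nodal s id) = 0) {p : K[X]} (hp : ∀ μ ∈ s, p.eval μ = 0) :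
    aeval M p = 0 := by
  have hdvd : Lagrange.nodal s id ∣ p := by
    rw [Lagrange.nodal_eq]
    refine Finset.prod_dvd_of_coprime (fun i _ j _ hij => ?_) fun i hi => ?_
    · exact pairwise_coprime_X_sub_C Function.injective_id hij
    · exact dvd_iff_isRoot.2 (hp i hi)
  obtain ⟨q, rfl⟩ := hdvd
  rw [map_mul, hM, zero_mul]

theorem exists_trace_eq_natCast_of_isIdempotentElem {P : Matrix m m K} (hP : IsIdempotentElem P) :
    ∃ r : ℕ, P.trace = r := by
  have h : IsIdempotentElem (Matrix.toLin' P) := by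
    rw [IsIdempotentElem, Module.End.mul_eq_comp, ← Matrix.toLin'_mul, hP.eq]
  exact ⟨_, by rw [← Matrix.trace_toLin'_eq]; exact (LinearMap.IsIdempotentElem.isProj_range _ h).trace⟩

theorem eq_zero_of_isIdempotentElem_of_trace_eq_zero [CharZero K] {P : Matrix m m K}
    (hP : IsIdempotentElem P) (h0 : P.trace = 0) : P = 0 := by
  have h : IsIdempotentElem (Matrix.toLin' P) := by
    rw [IsIdempotentElem, Module.End.mul_eq_comp, ← Matrix.toLin'_mul, hP.eq]
  rw [← Matrix.trace_toLin'_eq] at h0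
  exact Matrix.toLin'.map_eq_zero_iff.1 ((LinearMap.IsIdempotentElem.trace_eq_zero_iff h).1 h0)

variable [DecidableEq K]

/-- The polynomial in `M` that projects onto the `μ`-eigenspace, when `M` is annihilated by
`∏ ν ∈ s, (X - ν)`. -/
noncomputable def spectralProj (s : Finset K) (M : Matrix m m K) (μ : K) : Matrix m m K :=
  aeval M (Lagrange.basis s id μ)

theorem eval_basis_id {s : Finset K} {μ ν : K} (hμ : μ ∈ s) (hν : ν ∈ s) :
    (Lagrange.basis s id μ).eval ν = if ν = μ then 1 else 0 := by
  split_ifs with h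
  · subst h
    exact Lagrange.eval_basis_self (v := id) Function.injective_id.injOn hμ
  · exact Lagrange.eval_basis_of_ne (v := id) (Ne.symm h) hν

theorem aeval_eq_sum_spectralProj {s : Finset K} {M : Matrix m m K}
    (hM : aeval M (Lagrange.nodal s id) = 0) (p : K[X]) :
    aeval M p = ∑ μ ∈ s, p.eval μ • spectralProj s M μ := by
  have h : aeval M (p - ∑ μ ∈ s, C (p.eval μ) * Lagrange.basis s id μ) = 0 := by
    refine aeval_eq_zero_of_eval_eq_zero hM fun ν hν => ?_
    rw [eval_sub, eval_finsetSum, Finset.sum_eq_single_of_mem ν hν, eval_mul, eval_C,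
      eval_basis_id hν hν, if_pos rfl, mul_one, sub_self]
    intro μ hμ hne
    rw [eval_mul, eval_basis_id hμ hν, if_neg hne.symm, mul_zero]
  rw [map_sub, sub_eq_zero] at h
  rw [h, map_sum]
  refine Finset.sum_congr rfl fun μ _ => ?_
  rw [map_mul, aeval_C, ← Algebra.smul_def, spectralProj]

theorem aeval_mul_spectralProj {s : Finset K} {M : Matrix m m K}
    (hM : aeval M (Lagrange.nodal s id) = 0) (p : K[X]) {μ : K} (hμ : μ ∈ s) :
    aeval M p * spectralProj s M μ = p.eval μ • spectralProj s M μ := by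
  rw [spectralProj, ← map_mul, ← map_smul, ← sub_eq_zero, ← map_sub]
  refine aeval_eq_zero_of_eval_eq_zero hM fun ν hν => ?_
  rw [eval_sub, eval_mul, eval_smul, smul_eq_mul, eval_basis_id hμ hν]
  split_ifs with h <;> simp [h]

theorem isIdempotentElem_spectralProj {s : Finset K} {M : Matrix m m K}
    (hM : aeval M (Lagrange.nodal s id) = 0) {μ : K} (hμ : μ ∈ s) :
    IsIdempotentElem (spectralProj s M μ) := by
  have h := aeval_mul_spectralProj hM (Lagrange.basis s id μ) hμ
  rwa [eval_basis_id hμ hμ, if_pos rfl, one_smul] at h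

theorem commute_spectralProj {s : Finset K} {M N : Matrix m m K} (h : Commute M N) (μ : K) :
    Commute (spectralProj s M μ) N :=
  Algebra.commute_of_mem_adjoin_singleton_of_commute (aeval_mem_adjoin_singleton K M) h.symm |>.symm

theorem spectralProj_ne_zero {s : Finset K} {M : Matrix m m K} {μ : K} (hμ : μ ∈ s)
    (hroot : M.charpoly.IsRoot μ) : spectralProj s M μ ≠ 0 := fun h => by
  have h1 := eval_eq_zero_of_isRoot_charpoly hroot h
  rw [eval_basis_id hμ hμ, if_pos rfl] at h1
  exact one_ne_zero h1

/-- A field automorphism that raises the `n`-th roots of unity to the `k`-th power maps the trace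
of `P * R` to the trace of `P * R ^ k`, for an idempotent `P` that commutes with a matrix `R` of
order dividing `n`. -/
theorem map_trace_mul_eq_trace_mul_pow {n k : ℕ} (hn : 0 < n) {ζ : K} (hζ : IsPrimitiveRoot ζ n)
    (σ : K →+* K) (hσ : ∀ ξ : K, ξ ^ n = 1 → σ ξ = ξ ^ k) {P R : Matrix m m K}
    (hP : IsIdempotentElem P) (hPR : Commute P R) (hR : R ^ n = 1) :
    σ (P * R).trace = (P * R ^ k).trace := by
  set s := nthRootsFinset n (1 : K)
  have hM : aeval R (Lagrange.nodal s id) = 0 := by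
    have h := X_pow_sub_one_eq_prod hn hζ
    rw [Lagrange.nodal_eq]
    simp only [id]
    rw [← h]
    simp [hR]
  have key : ∀ j : ℕ, (P * R ^ j).trace = ∑ ξ ∈ s, ξ ^ j * (P * spectralProj s R ξ).trace := by
    intro j
    have h := aeval_eq_sum_spectralProj hM (X ^ j)
    rw [map_pow, aeval_X] at h
    rw [h, Finset.mul_sum, Matrix.trace_sum]
    refine Finset.sum_congr rfl fun ξ _ => ?_
    rw [Matrix.mul_smul, Matrix.trace_smul, smul_eq_mul, eval_pow, eval_X]
  have h1 := key 1
  rw [pow_one] at h1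
  rw [h1, key k, map_sum]
  refine Finset.sum_congr rfl fun ξ hξ => ?_
  have hc : Commute P (spectralProj s R ξ) := (commute_spectralProj hPR.symm ξ).symm
  -- The coefficient of `ξ` is the rank of an idempotent, so `σ` fixes it.
  obtain ⟨r, hr⟩ := exists_trace_eq_natCast_of_isIdempotentElem
    (IsIdempotentElem.mul_of_commute hc hP (isIdempotentElem_spectralProj hM hξ))
  rw [hr, pow_one, map_mul, map_natCast, hσ ξ ((mem_nthRootsFinset hn _).1 hξ)]

end SpectralProjections

/-! ### Diagonalizability of rational symmetric matrices. -/

section RationalSymmetric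

variable {m : Type*} [Fintype m] [DecidableEq m]

/-- If the minimal polynomial is `d * d * c`, then `N = (d * c)(M)` is symmetric with `N * N = 0`,
so `Nᵀ * N = 0` and `N = 0` over `ℚ`; minimality then makes `d` a unit. -/
theorem squarefree_minpoly_of_isSymm {M : Matrix m m ℚ} (hM : M.IsSymm) :
    Squarefree (minpoly ℚ M) := by
  rintro d ⟨c, hc⟩
  have hint : IsIntegral ℚ M := Algebra.IsIntegral.isIntegral M
  have hne : minpoly ℚ M ≠ 0 := minpoly.ne_zero hint
  have hsq : aeval M (d * c) * aeval M (d * c) = 0 := by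
    rw [← map_mul, show d * c * (d * c) = minpoly ℚ M * c by rw [hc]; ring, map_mul,
      minpoly.aeval, zero_mul]
  have hsymm : (aeval M (d * c)).transpose = aeval M (d * c) := by
    rw [aeval_eq_sum_range, Matrix.transpose_sum]
    refine Finset.sum_congr rfl fun i _ => ?_
    rw [Matrix.transpose_smul, Matrix.transpose_pow, hM]
  have h0 : aeval M (d * c) = 0 := by
    rw [← Matrix.conjTranspose_mul_self_eq_zero, Matrix.conjTranspose_eq_transpose_of_trivial,
      hsymm, hsq]
  have hdvd := minpoly.dvd ℚ M h0
  rw [hc] at hdvd hne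
  have hdc : d * c ≠ 0 := fun h => hne (by rw [mul_assoc, h, mul_zero])
  rw [mul_assoc] at hdvd
  nth_rewrite 2 [← one_mul (d * c)] at hdvd
  exact isUnit_of_dvd_one ((mul_dvd_mul_iff_right hdc).1 hdvd)

theorem exists_aeval_nodal_eq_zero {K : Type*} [Field K] [IsAlgClosed K] [Algebra ℚ K]
    [DecidableEq K] {M : Matrix m m ℚ} (hM : M.IsSymm) :
    ∃ s : Finset K, aeval (M.map (algebraMap ℚ K)) (Lagrange.nodal s id) = 0 ∧
      ∀ μ, μ ∈ s ↔ aeval μ M.charpoly = 0 := by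
  have hsep : (minpoly ℚ M).Separable :=
    PerfectField.separable_iff_squarefree.2 (squarefree_minpoly_of_isSymm hM)
  have hmonic : (minpoly ℚ M).Monic := minpoly.monic (Algebra.IsIntegral.isIntegral M)
  have hmap : ∀ p : ℚ[X], aeval (M.map (algebraMap ℚ K)) (p.map (algebraMap ℚ K)) =
      (aeval M p).map (algebraMap ℚ K) := by
    intro p
    rw [aeval_map_algebraMap]
    exact aeval_algHom_apply (Algebra.ofId ℚ K).mapMatrix M p
  have hnod : aeval (M.map (algebraMap ℚ K))
      (Lagrange.nodal ((minpoly ℚ M).aroots K).toFinset id) = 0 := by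
    have hprod : Lagrange.nodal ((minpoly ℚ M).aroots K).toFinset id =
        (minpoly ℚ M).map (algebraMap ℚ K) := by
      rw [Lagrange.nodal_eq]
      conv_rhs => rw [(IsAlgClosed.splits ((minpoly ℚ M).map
        (algebraMap ℚ K))).eq_prod_roots_of_monic (hmonic.map _)]
      rw [Finset.prod, Multiset.toFinset_val, Multiset.dedup_eq_self.2
        (nodup_roots hsep.map)]
      rfl
    rw [hprod, hmap, minpoly.aeval]
    simp
  refine ⟨_, hnod, fun μ => ?_⟩
  rw [Multiset.mem_toFinset, mem_aroots]
  constructor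
  · rintro ⟨-, h⟩
    exact aeval_eq_zero_of_dvd_aeval_eq_zero (Matrix.minpoly_dvd_charpoly M) h
  · intro h
    refine ⟨hmonic.ne_zero, ?_⟩
    have hroot : (M.map (algebraMap ℚ K)).charpoly.IsRoot μ := by
      rw [Matrix.charpoly_map, IsRoot, eval_map_algebraMap, h]
    rw [← eval_map_algebraMap]
    exact eval_eq_zero_of_isRoot_charpoly hroot (by rw [hmap, minpoly.aeval]; simp)

end RationalSymmetric

/-! ### Galois action on roots of unity. -/

section RootsOfUnity

variable {K : Type*} [Field K] {n : ℕ} {ζ : K}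

theorem map_eq_pow_of_pow_eq_one (hn : 0 < n) (hζ : IsPrimitiveRoot ζ n) (σ : K →+* K) {k : ℕ}
    (hσ : σ ζ = ζ ^ k) (ξ : K) (hξ : ξ ^ n = 1) : σ ξ = ξ ^ k := by
  have : NeZero n := ⟨hn.ne'⟩
  obtain ⟨i, -, rfl⟩ := hζ.eq_pow_of_pow_eq_one hξ
  rw [map_pow, hσ, pow_right_comm]

theorem exists_coprime_map_eq_pow (hn : 0 < n) (hζ : IsPrimitiveRoot ζ n) (σ : K →+* K) :
    ∃ k : ℕ, k.Coprime n ∧ σ ζ = ζ ^ k := by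
  have : NeZero n := ⟨hn.ne'⟩
  have hσζ : IsPrimitiveRoot (σ ζ) n := hζ.map_of_injective σ.injective
  obtain ⟨k, -, hk⟩ := hζ.eq_pow_of_pow_eq_one hσζ.pow_eq_one
  exact ⟨k, (hζ.pow_iff_coprime hn k).1 (hk ▸ hσζ), hk.symm⟩

theorem exists_algEquiv_map_eq_pow [CharZero K] [Algebra ℚ K] [Normal ℚ K] (hn : 0 < n)
    (hζ : IsPrimitiveRoot ζ n) {k : ℕ} (hk : k.Coprime n) : ∃ σ : K ≃ₐ[ℚ] K, σ ζ = ζ ^ k := by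
  have hconj : IsConjRoot ℚ (ζ ^ k) ζ := by
    rw [isConjRoot_def, minpoly.isIntegrallyClosed_eq_field_fractions' ℚ (hζ.isIntegral hn),
      minpoly.isIntegrallyClosed_eq_field_fractions' ℚ ((hζ.isIntegral hn).pow k),
      hζ.minpoly_eq_pow_coprime hk]
  exact hconj.exists_algEquiv

end RootsOfUnity

/-! ### Convolution matrices and the right regular representation. -/

section RightTranslation

variable {G : Type*} [Group G] [Fintype G] [DecidableEq G] (K : Type*) [Field K]

/-- The permutation matrices of the right regular representation. -/
def rightTranslation : G →* Matrix G G K where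
  toFun v := Matrix.of fun g k => if k = g * v then 1 else 0
  map_one' := by
    ext g k
    simp [Matrix.one_apply, eq_comm]
  map_mul' v w := by
    ext g k
    rw [Matrix.mul_apply, Finset.sum_eq_single (g * v)]
    · simp [mul_assoc]
    · intro j _ hj
      simp [hj]
    · simp

variable {K}

theorem rightTranslation_apply (v g k : G) :
    rightTranslation K v g k = if k = g * v then 1 else 0 := rfl

theorem mul_rightTranslation_apply (c : G → K) (v g k : G) :
    ((Matrix.of fun a b => c (a * b⁻¹)) * rightTranslation K v) g k = c (g * v * k⁻¹) := by
  rw [Matrix.mul_apply, Finset.sum_eq_single (k * v⁻¹)]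
  · simp [rightTranslation_apply, mul_assoc]
  · intro l _ hl
    rw [rightTranslation_apply, if_neg, mul_zero]
    rintro rfl
    simp at hl
  · simp

theorem commute_rightTranslation (c : G → K) (v : G) :
    Commute (Matrix.of fun a b => c (a * b⁻¹)) (rightTranslation K v) := by
  ext g k
  rw [mul_rightTranslation_apply, Matrix.mul_apply]
  simp [rightTranslation_apply]

theorem trace_mul_rightTranslation {c : G → K} (hc : IsClassFunction c) (v : G) :
    ((Matrix.of fun a b => c (a * b⁻¹)) * rightTranslation K v).trace = Fintype.card G * c v := by
  simp only [Matrix.trace, Matrix.diag_apply, mul_rightTranslation_apply, hc _ v,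
    Finset.sum_const, Finset.card_univ, nsmul_eq_mul]

theorem eq_sum_smul_rightTranslation {c : G → K} (hc : IsClassFunction c) :
    (Matrix.of fun a b => c (a * b⁻¹)) = ∑ w, c w⁻¹ • rightTranslation K w := by
  ext g k
  rw [Matrix.sum_apply, Finset.sum_eq_single (g⁻¹ * k)]
  · rw [Matrix.smul_apply, rightTranslation_apply, if_pos (by simp), ← hc g (g⁻¹ * k)⁻¹]
    simp [mul_assoc]
  · intro w _ hw
    rw [Matrix.smul_apply, rightTranslation_apply, if_neg, smul_zero]
    rintro rfl
    simp at hw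
  · simp

/-- A matrix that is trace-orthogonal to the right translations is trace-orthogonal to all
polynomials in the convolution matrix of a class function. -/
theorem trace_mul_aeval_eq_zero {c : G → K} (hc : IsClassFunction c) {D : Matrix G G K}
    (hD : ∀ w, (D * rightTranslation K w).trace = 0) (p : K[X]) :
    (D * aeval (Matrix.of fun a b => c (a * b⁻¹)) p).trace = 0 := by
  -- The image of the group algebra is the span of the right translations; it contains the matrix
  -- because `c` is a class function.
  let S := (MonoidAlgebra.lift K (Matrix G G K) G (rightTranslation K)).range
  have hA : (Matrix.of fun a b => c (a * b⁻¹)) ∈ S := by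
    rw [eq_sum_smul_rightTranslation hc]
    exact sum_mem fun w _ => S.smul_mem ⟨MonoidAlgebra.of K G w, by simp⟩ _
  have hp : aeval (Matrix.of fun a b => c (a * b⁻¹)) p ∈ S :=
    Algebra.adjoin_le (Set.singleton_subset_iff.2 hA) (aeval_mem_adjoin_singleton K _)
  obtain ⟨x, hx⟩ := hp
  rw [← hx]
  simp only [AlgHom.toRingHom_eq_coe, RingHom.coe_coe, MonoidAlgebra.lift_apply]
  rw [Finsupp.sum, Finset.mul_sum, Matrix.trace_sum]
  refine Finset.sum_eq_zero fun w _ => ?_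
  rw [Matrix.mul_smul, Matrix.trace_smul, hD, smul_zero]

end RightTranslation

/-! ### Eigenvalues in `ℂ` and in an algebraic closure of `ℚ`. -/

namespace ColourGraph

variable {V : Type*} [Fintype V] [DecidableEq V] (Γ : ColourGraph V)

theorem mem_spectrum_iff {μ : ℂ} : μ ∈ Γ.spectrum ↔ aeval μ Γ.adjMatrix.charpoly = 0 := by
  rw [spectrum, adjPolynomial, mem_aroots]
  exact and_iff_right Γ.adjMatrix.charpoly_monic.ne_zero

theorem isRational_iff (K : Type*) [Field K] [IsAlgClosed K] [Algebra ℚ K]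
    [Algebra.IsAlgebraic ℚ K] : Γ.IsRational ↔
      ∀ μ : K, aeval μ Γ.adjMatrix.charpoly = 0 → ∃ q : ℚ, μ = algebraMap ℚ K q := by
  let φ : K →ₐ[ℚ] ℂ := IsAlgClosed.lift
  constructor
  · intro h μ hμ
    obtain ⟨q, hq⟩ := h (φ μ) (Γ.mem_spectrum_iff.2 (by rw [aeval_algHom_apply, hμ, map_zero]))
    refine ⟨q, φ.injective ?_⟩
    change φ μ = φ (algebraMap ℚ K q)
    rw [hq, AlgHom.commutes, eq_ratCast]
  · intro h μ hμ
    rw [mem_spectrum_iff] at hμ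
    have hμ' : ((Γ.adjMatrix.charpoly.map (algebraMap ℚ K)).map (φ : K →+* ℂ)).IsRoot μ := by
      rw [Polynomial.map_map, AlgHom.comp_algebraMap, IsRoot, eval_map_algebraMap, hμ]
    obtain ⟨x, rfl⟩ := (IsAlgClosed.splits _).mem_range_of_isRoot
      (Γ.adjMatrix.charpoly_monic.map _).ne_zero hμ'
    obtain ⟨q, rfl⟩ := h x (φ.injective (by
      change φ _ = φ 0
      rw [← aeval_algHom_apply, map_zero]
      exact hμ))
    exact ⟨q, by simp⟩

/-- Eigenvalues of an integer matrix are algebraic integers, and `ℤ` is integrally closed. -/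
theorem isIntegral_iff_isRational (hΓ : ∀ u v, ∃ z : ℤ, Γ.colour u v = z) :
    Γ.IsIntegral ↔ Γ.IsRational := by
  refine ⟨fun h μ hμ => ?_, fun h μ hμ => ?_⟩
  · obtain ⟨z, rfl⟩ := h μ hμ
    exact ⟨z, by simp⟩
  · obtain ⟨q, rfl⟩ := h μ hμ
    choose B hB using hΓ
    have hA : Γ.adjMatrix = (Matrix.of B).map (algebraMap ℤ ℚ) := by
      ext u v
      simp [adjMatrix, hB]
    rw [mem_spectrum_iff, hA, Matrix.charpoly_map, aeval_map_algebraMap] at hμ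
    have hint : _root_.IsIntegral ℤ (algebraMap ℚ ℂ q) :=
      ⟨(Matrix.of B).charpoly, (Matrix.of B).charpoly_monic, by
        rw [← aeval_def]; simpa using hμ⟩
    obtain ⟨z, hz⟩ := IsIntegrallyClosed.isIntegral_iff.1
      ((isIntegral_algebraMap_iff (algebraMap ℚ ℂ).injective).1 hint)
    exact ⟨z, by rw [← hz]; simp⟩

end ColourGraph

section PowFun

variable {G α : Type*} [Group G] [Fintype G]

theorem forall_unitPowFun_eq_iff (f : G → α) :
    (∀ h : (ZMod (Fintype.card G))ˣ, unitPowFun f h = f) ↔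
      ∀ k : ℕ, k.Coprime (Fintype.card G) → ∀ g, f (g ^ k) = f g := by
  constructor
  · intro H k hk g
    have h := H (ZMod.unitOfCoprime k hk)
    rw [unitPowFun_eq f _ k (by simp)] at h
    simpa [powFun] using congrFun h g
  · intro H h
    funext g
    simpa [unitPowFun, powFun, -ZMod.natCast_val] using H _ (ZMod.val_coe_unit_coprime h) g

end PowFun

/-! ### The Galois argument. -/

section Main

variable {G : Type*} [Group G] [Fintype G] [DecidableEq G]

theorem sum_mul_trace_spectralProj_mul {K : Type*} [Field K] [DecidableEq K] {s : Finset K}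
    {c : G → K} (hc : IsClassFunction c)
    (hs : aeval (Matrix.of fun a b => c (a * b⁻¹)) (Lagrange.nodal s id) = 0) (v : G) :
    ∑ μ ∈ s, μ * (spectralProj s (Matrix.of fun a b => c (a * b⁻¹)) μ *
      rightTranslation K v).trace = Fintype.card G * c v := by
  have h := aeval_eq_sum_spectralProj hs X
  rw [aeval_X] at h
  rw [← trace_mul_rightTranslation hc]
  conv_rhs => rw [h]
  simp [Finset.sum_mul, Matrix.trace_sum]

theorem isRational_cayleyColourGraph_iff (K : Type*) [Field K] [CharZero K] [IsAlgClosed K]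
    [Algebra ℚ K] [IsGalois ℚ K] (f : G → ℚ) (hinv : ∀ g, f g = f g⁻¹)
    (hclass : IsClassFunction f) : (cayleyColourGraph f hinv).IsRational ↔
      ∀ k : ℕ, k.Coprime (Fintype.card G) → ∀ g, f (g ^ k) = f g := by
  classical
  set n := Fintype.card G
  have hn : 0 < n := Fintype.card_pos
  have : NeZero n := ⟨hn.ne'⟩
  obtain ⟨ζ, hζ⟩ := HasEnoughRootsOfUnity.exists_primitiveRoot K n
  let c : G → K := fun g => algebraMap ℚ K (f g)
  have hc : IsClassFunction c := fun g h => congrArg (algebraMap ℚ K) (hclass g h)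
  set A : Matrix G G K := Matrix.of fun a b => c (a * b⁻¹)
  have hAmap : (cayleyColourGraph f hinv).adjMatrix.map (algebraMap ℚ K) = A := rfl
  obtain ⟨s, hs, hmem⟩ := exists_aeval_nodal_eq_zero (K := K)
    (M := (cayleyColourGraph f hinv).adjMatrix)
    (Matrix.IsSymm.ext fun u v => (cayleyColourGraph f hinv).symm v u)
  rw [hAmap] at hs
  have hR : ∀ v : G, rightTranslation K v ^ n = 1 := fun v => by
    rw [← map_pow, pow_card_eq_one, map_one]
  have hsum := sum_mul_trace_spectralProj_mul hc hs
  have hgal : ∀ (σ : K ≃ₐ[ℚ] K) (k : ℕ), σ ζ = ζ ^ k → ∀ v : G,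
      ∑ μ ∈ s, σ μ * (spectralProj s A μ * rightTranslation K (v ^ k)).trace = n * c v := by
    intro σ k hk v
    have h := congrArg σ (hsum v)
    rw [map_mul, map_natCast, AlgEquiv.commutes, map_sum] at h
    rw [← h]
    refine Finset.sum_congr rfl fun μ hμ => ?_
    rw [map_mul, map_pow]
    congr 1
    exact (map_trace_mul_eq_trace_mul_pow hn hζ (σ : K →+* K)
      (map_eq_pow_of_pow_eq_one hn hζ _ hk) (isIdempotentElem_spectralProj hs hμ)
      (commute_spectralProj (commute_rightTranslation c v) μ) (hR v)).symm
  rw [ColourGraph.isRational_iff _ K]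
  constructor
  · intro hrat k hk v
    obtain ⟨σ, hσ⟩ := exists_algEquiv_map_eq_pow hn hζ hk
    have h1 := hgal σ k hσ v
    have h2 := hsum (v ^ k)
    have h3 : (n : K) * c (v ^ k) = n * c v := by
      rw [← h1, ← h2]
      refine Finset.sum_congr rfl fun μ hμ => ?_
      obtain ⟨q, rfl⟩ := hrat μ ((hmem μ).1 hμ)
      rw [AlgEquiv.commutes]
    exact (algebraMap ℚ K).injective (mul_left_cancel₀ (Nat.cast_ne_zero.2 hn.ne') h3)
  · intro hpow μ hμ
    have hfix : ∀ σ : K ≃ₐ[ℚ] K, σ μ = μ := by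
      intro σ
      obtain ⟨k, hk, hσ⟩ := exists_coprime_map_eq_pow hn hζ (σ : K →+* K)
      let p : K[X] := Lagrange.interpolate s id fun ν => σ ν - ν
      have hp : ∀ ν ∈ s, p.eval ν = σ ν - ν := fun ν hν =>
        Lagrange.eval_interpolate_at_node (v := id) _ Function.injective_id.injOn hν
      have hD : ∀ w, (aeval A p * rightTranslation K w).trace = 0 := by
        intro w
        -- As `k` is coprime to the group order, every element is a `k`-th power.
        obtain ⟨v, rfl⟩ := (powCoprime (G := G)
          (by rw [Nat.card_eq_fintype_card]; exact hk.symm)).surjective w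
        rw [aeval_eq_sum_spectralProj hs, Finset.sum_mul, Matrix.trace_sum, powCoprime_apply]
        calc _ = ∑ ν ∈ s, (σ ν * (spectralProj s A ν * rightTranslation K (v ^ k)).trace -
              ν * (spectralProj s A ν * rightTranslation K (v ^ k)).trace) := by
              refine Finset.sum_congr rfl fun ν hν => ?_
              rw [hp ν hν, Matrix.smul_mul, Matrix.trace_smul, smul_eq_mul, sub_mul]
          _ = 0 := by
              rw [Finset.sum_sub_distrib, hgal σ k hσ v, hsum (v ^ k)]
              simp only [c, hpow k hk v, sub_self, n]
      have hμs := (hmem μ).2 hμ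
      have h0 := trace_mul_aeval_eq_zero hc hD (Lagrange.basis s id μ)
      change (aeval A p * spectralProj s A μ).trace = 0 at h0
      rw [aeval_mul_spectralProj hs _ hμs, Matrix.trace_smul, smul_eq_mul, hp μ hμs] at h0
      refine sub_eq_zero.1 ((mul_eq_zero.1 h0).resolve_right fun htr => ?_)
      refine spectralProj_ne_zero hμs ?_ (eq_zero_of_isIdempotentElem_of_trace_eq_zero
        (isIdempotentElem_spectralProj hs hμs) htr)
      rw [← hAmap, Matrix.charpoly_map, IsRoot, eval_map_algebraMap, hμ]
    obtain ⟨q, hq⟩ := (InfiniteGalois.mem_range_algebraMap_iff_fixed μ).2 hfix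
    exact ⟨q, hq.symm⟩

end Main

theorem mainTheorem7 {G : Type*} [Group G] [Fintype G] [DecidableEq G]
    (f : G → ℚ) (hinv : ∀ g, f g = f g⁻¹) (hclass : IsClassFunction f) :
    ((cayleyColourGraph f hinv).IsRational ↔
      ∀ h : (ZMod (Fintype.card G))ˣ, unitPowFun f h = f) ∧
    ((∀ g, ∃ z : ℤ, f g = (z : ℚ)) →
      ((cayleyColourGraph f hinv).IsIntegral ↔
        ∀ h : (ZMod (Fintype.card G))ˣ, unitPowFun f h = f)) := by
  let _ : Algebra ℚ (AlgebraicClosure ℚ) := AlgebraicClosure.instAlgebra ℚ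
  have : IsGalois ℚ (AlgebraicClosure ℚ) := IsAlgClosure.isGalois ℚ _
  have hrat := (isRational_cayleyColourGraph_iff (AlgebraicClosure ℚ) f hinv hclass).trans
    (forall_unitPowFun_eq_iff f).symm
  refine ⟨hrat, fun hint => ?_⟩
  rw [ColourGraph.isIntegral_iff_isRational _ fun u v => hint (u * v⁻¹)]
  exact hrat
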